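/- Let $p$ be a prime number, let $R$ be a commutative ring of characteristic $p$, let $n\ge 0$ be an integer, and let $A=A_n(R)$ be the $n$-th Weyl algebra over $R$, i.e. the $R$-algebra generated by $x_1,\dots,x_n,\partial_1,\dots,\partial_n$ with relations $[x_i,x_j]=0$, $[\partial_i,\partial_j]=0$ and $[\partial_i,x_j]=\delta_{ij}$ for $i,j=1,\dots,n$, where $[a,b]=ab-ba$. Put $$C=R[x_1^p,\dots,x_n^p,\partial_1^p,\dots,\partial_n^p]\subset A,$$ a commutative subalgebra contained in the center of $A$. For a ring $S$ and a ring endomorphism $\varphi:S\to S$, let ${}_\varphi S_\varphi$ denote the $S$-bimodule with underlying abelian group $S$ and multiplication $a\cdot s\cdot b=\varphi(a)\,s\,\varphi(b)$, and let ${}_\varphi S$ denote the left $S$-module with underlying abelian group $S$ and multiplication $a\cdot s=\varphi(a)s$. Let $\varphi:A\to A$ be an $R$-algebra homomorphism. Then: (i) $\varphi(C)\subset C$; write $\varphi|_C:C\to C$ for the restriction. (ii) $\varphi$ is an isomorphism if and only if $\varphi|_C$ is an isomorphism. (iii) The bimodule ${}_\varphi A_\varphi$ is $C$-linear, i.e.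 $c\cdot m=m\cdot c$ for all $c\in C$ and $m\in{}_\varphi A_\varphi$. Its invariants $$({}_\varphi A_\varphi)^A=\{m\in{}_\varphi A_\varphi\mid a\cdot m=m\cdot a\text{ for all }a\in A\}$$ form the subset $C$ of $A$, and as a $C$-module they are ${}_{\varphi|_C}C$. Furthermore, ${}_\varphi A_\varphi$ is finitely generated as an $A$-bimodule if and only if $\varphi|_C$ is finite, i.e. $C$ is a finitely generated module over itself through $\varphi|_C$. -/

import Mathlib

open MulOpposite

/-! ### The Weyl algebra -/

namespace WeylAlgebra

/-- The defining relations of the `n`-th Weyl algebra, on the free `R`-algebra whose generators are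
`x_i` (indexed by `Sum.inl i`) and `∂_i` (indexed by `Sum.inr i`). -/
inductive Rel (R : Type*) [CommRing R] (n : ℕ) :
    FreeAlgebra R (Fin n ⊕ Fin n) → FreeAlgebra R (Fin n ⊕ Fin n) → Prop
  | x_x (i j : Fin n) :
      Rel R n
        (FreeAlgebra.ι R (Sum.inl i) * FreeAlgebra.ι R (Sum.inl j)
          - FreeAlgebra.ι R (Sum.inl j) * FreeAlgebra.ι R (Sum.inl i)) 0
  | d_d (i j : Fin n) :
      Rel R n
        (FreeAlgebra.ι R (Sum.inr i) * FreeAlgebra.ι R (Sum.inr j)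
          - FreeAlgebra.ι R (Sum.inr j) * FreeAlgebra.ι R (Sum.inr i)) 0
  | d_x (i j : Fin n) :
      Rel R n
        (FreeAlgebra.ι R (Sum.inr i) * FreeAlgebra.ι R (Sum.inl j)
          - FreeAlgebra.ι R (Sum.inl j) * FreeAlgebra.ι R (Sum.inr i)) (if i = j then 1 else 0)

end WeylAlgebra

/-- The `n`-th Weyl algebra `A_n(R)`: the `R`-algebra generated by `x_1, …, x_n, ∂_1, …, ∂_n` with
relations `[x_i, x_j] = 0`, `[∂_i, ∂_j] = 0` and `[∂_i, x_j] = δ_ij`. -/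
def WeylAlgebra (R : Type*) [CommRing R] (n : ℕ) : Type _ := RingQuot (WeylAlgebra.Rel R n)

namespace WeylAlgebra

variable (R : Type*) [CommRing R] (n : ℕ)

instance : Ring (WeylAlgebra R n) := inferInstanceAs (Ring (RingQuot (Rel R n)))

instance : Algebra R (WeylAlgebra R n) := inferInstanceAs (Algebra R (RingQuot (Rel R n)))

/-- The quotient map from the free algebra. -/
def mk : FreeAlgebra R (Fin n ⊕ Fin n) →ₐ[R] WeylAlgebra R n := RingQuot.mkAlgHom R (Rel R n)

/-- The generator `x_i`. -/
def x (i : Fin n) : WeylAlgebra R n := mk R n (FreeAlgebra.ι R (Sum.inl i))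

/-- The generator `∂_i`. -/
def d (i : Fin n) : WeylAlgebra R n := mk R n (FreeAlgebra.ι R (Sum.inr i))

/-- The subalgebra `C = R[x_1^p, …, x_n^p, ∂_1^p, …, ∂_n^p]` of `A_n(R)`. -/
def pPowers (p : ℕ) : Subalgebra R (WeylAlgebra R n) :=
  Algebra.adjoin R (Set.range (fun i => x R n i ^ p) ∪ Set.range (fun i => d R n i ^ p))

theorem mk_rel {a b : FreeAlgebra R (Fin n ⊕ Fin n)} (h : Rel R n a b) : mk R n a = mk R n b :=
  RingQuot.mkAlgHom_rel R h

theorem x_comm (i j : Fin n) : Commute (x R n i) (x R n j) := by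
  have h := mk_rel R n (Rel.x_x i j)
  rw [map_sub, map_mul, map_mul, map_zero, sub_eq_zero] at h
  exact h

theorem d_comm (i j : Fin n) : Commute (d R n i) (d R n j) := by
  have h := mk_rel R n (Rel.d_d i j)
  rw [map_sub, map_mul, map_mul, map_zero, sub_eq_zero] at h
  exact h

theorem d_mul_x (i j : Fin n) :
    d R n i * x R n j - x R n j * d R n i = if i = j then 1 else 0 := by
  have h := mk_rel R n (Rel.d_x i j)
  rw [map_sub, map_mul, map_mul] at h
  refine h.trans ?_
  split_ifs <;> simp

theorem adjoin_generators :
    Algebra.adjoin R (Set.range (x R n) ∪ Set.range (d R n)) = ⊤ := by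
  have hs : Function.Surjective (mk R n) := RingQuot.mkAlgHom_surjective R (Rel R n)
  rw [← AlgHom.range_eq_top] at hs
  rw [← hs, ← Algebra.map_top, ← FreeAlgebra.adjoin_range_ι, AlgHom.map_adjoin]
  congr 1
  ext y
  constructor
  · rintro (⟨i, rfl⟩ | ⟨i, rfl⟩)
    · exact ⟨_, ⟨Sum.inl i, rfl⟩, rfl⟩
    · exact ⟨_, ⟨Sum.inr i, rfl⟩, rfl⟩
  · rintro ⟨_, ⟨i | i, rfl⟩, rfl⟩
    · exact Or.inl ⟨i, rfl⟩
    · exact Or.inr ⟨i, rfl⟩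

/-- If `[a, b] = z` commutes with `b`, then `[a, b^k] = k z b^(k-1)`. -/
theorem commutator_pow {S : Type*} [Ring S] {a b z : S} (h : a * b - b * a = z)
    (hz : Commute z b) (k : ℕ) : a * b ^ k - b ^ k * a = k * (z * b ^ (k - 1)) := by
  induction k with
  | zero => simp
  | succ k ih =>
    have e : a * b ^ (k + 1) - b ^ (k + 1) * a
        = (a * b ^ k - b ^ k * a) * b + b ^ k * (a * b - b * a) := by
      rw [pow_succ]; noncomm_ring
    rw [e, ih, h, ← (hz.pow_right k).eq, Nat.add_sub_cancel]
    rcases k with _ | k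
    · simp
    · rw [Nat.add_sub_cancel, mul_assoc, mul_assoc, ← pow_succ]
      push_cast
      noncomm_ring

theorem commute_pow_of_charP (p : ℕ) [CharP R p] {S : Type*} [Ring S] [Algebra R S] {a b z : S}
    (h : a * b - b * a = z) (hz : Commute z b) : Commute a (b ^ p) := by
  have h0 : (p : S) = 0 := by
    rw [← map_natCast (algebraMap R S) p, CharP.cast_eq_zero R p, map_zero]
  have h1 := commutator_pow h hz p
  rw [h0, zero_mul, sub_eq_zero] at h1
  exact h1

theorem mem_center_of_commute {c : WeylAlgebra R n} (hx : ∀ i, Commute (x R n i) c)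
    (hd : ∀ i, Commute (d R n i) c) : c ∈ Subalgebra.center R (WeylAlgebra R n) := by
  rw [Subalgebra.mem_center_iff]
  intro b
  have hb : b ∈ Algebra.adjoin R (Set.range (x R n) ∪ Set.range (d R n)) := by
    rw [adjoin_generators]; trivial
  induction hb using Algebra.adjoin_induction with
  | mem y hy =>
    rcases hy with ⟨i, rfl⟩ | ⟨i, rfl⟩
    · exact hx i
    · exact hd i
  | algebraMap r => exact Algebra.commutes r c
  | add y z _ _ hy hz => rw [add_mul, mul_add, hy, hz]
  | mul y z _ _ hy hz => rw [mul_assoc, hz, ← mul_assoc, hy, mul_assoc]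

theorem pPowers_le_center (p : ℕ) [CharP R p] :
    pPowers R n p ≤ Subalgebra.center R (WeylAlgebra R n) := by
  refine Algebra.adjoin_le ?_
  rintro _ (⟨i, rfl⟩ | ⟨i, rfl⟩)
  · refine mem_center_of_commute R n (fun j => (x_comm R n j i).pow_right p) (fun j => ?_)
    refine commute_pow_of_charP R p (d_mul_x R n j i) ?_
    split_ifs
    · exact Commute.one_left _
    · exact Commute.zero_left _
  · refine mem_center_of_commute R n (fun j => ?_) (fun j => (d_comm R n j i).pow_right p)
    have h := d_mul_x R n i j
    rw [← neg_sub, neg_eq_iff_eq_neg] at h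
    refine commute_pow_of_charP R p h ?_
    split_ifs
    · exact (Commute.one_left _).neg_left
    · exact (Commute.zero_left _).neg_left

instance (p : ℕ) [CharP R p] : CommRing (pPowers R n p) :=
  { (inferInstance : Ring (pPowers R n p)) with
    mul_comm := fun a b => Subtype.ext
      ((Subalgebra.mem_center_iff.1 (pPowers_le_center R n p b.2)) a) }

variable {R n}

/-- The restriction `φ|_C : C → C` of an endomorphism `φ` of `A_n(R)` with `φ(C) ⊆ C`. -/
def restrict {p : ℕ} (φ : WeylAlgebra R n →ₐ[R] WeylAlgebra R n)
    (h : ∀ c ∈ pPowers R n p, φ c ∈ pPowers R n p) : pPowers R n p →ₐ[R] pPowers R n p :=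
  (φ.comp (pPowers R n p).val).codRestrict (pPowers R n p) (fun c => h c c.2)

end WeylAlgebra

/-! ### Twisted modules and bimodules

An `S`-bimodule is an abelian group `M` with a left `S`-module structure `Module S M`, a right
`S`-module structure `Module Sᵐᵒᵖ M` (`op y • m` is `m y`), and `SMulCommClass S Sᵐᵒᵖ M`. -/

/-- The left module `_φS`: the abelian group `S` with `a s = φ(a) s`. -/
def LeftTwist {S : Type*} [Ring S] (_φ : S →+* S) : Type _ := S

namespace LeftTwist

variable {S : Type*} [Ring S] (φ : S →+* S)

instance : AddCommGroup (LeftTwist φ) := inferInstanceAs (AddCommGroup S)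

/-- The identity map `S → _φS`. -/
def of : S ≃+ LeftTwist φ := AddEquiv.refl S

instance : Module S (LeftTwist φ) where
  smul a s := of φ (φ a * (of φ).symm s)
  one_smul := fun (s : S) => show φ 1 * (s : S) = s by rw [map_one, one_mul]
  mul_smul a b := fun (s : S) => show φ (a * b) * (s : S) = φ a * (φ b * s) by rw [map_mul, mul_assoc]
  smul_zero a := show φ a * (0 : S) = 0 from mul_zero _
  smul_add a := fun (s t : S) => show φ a * (s + t) = φ a * s + φ a * t from mul_add _ _ _
  add_smul a b := fun (s : S) => show φ (a + b) * (s : S) = φ a * s + φ b * s by rw [map_add, add_mul]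
  zero_smul := fun (s : S) => show φ 0 * (s : S) = 0 by rw [map_zero, zero_mul]

theorem smul_of (a s : S) : a • of φ s = of φ (φ a * s) := rfl

end LeftTwist

/-- The bimodule `_φS_φ`: the abelian group `S` with `a s b = φ(a) s φ(b)`. -/
def BiTwist {S : Type*} [Ring S] (_φ : S →+* S) : Type _ := S

namespace BiTwist

variable {S : Type*} [Ring S] (φ : S →+* S)

instance : AddCommGroup (BiTwist φ) := inferInstanceAs (AddCommGroup S)

/-- The identity map `S → _φS_φ`. -/
def of : S ≃+ BiTwist φ := AddEquiv.refl S

instance : Module S (BiTwist φ) where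
  smul a s := of φ (φ a * (of φ).symm s)
  one_smul := fun (s : S) => show φ 1 * (s : S) = s by rw [map_one, one_mul]
  mul_smul a b := fun (s : S) => show φ (a * b) * (s : S) = φ a * (φ b * s) by rw [map_mul, mul_assoc]
  smul_zero a := show φ a * (0 : S) = 0 from mul_zero _
  smul_add a := fun (s t : S) => show φ a * (s + t) = φ a * s + φ a * t from mul_add _ _ _
  add_smul a b := fun (s : S) => show φ (a + b) * (s : S) = φ a * s + φ b * s by rw [map_add, add_mul]
  zero_smul := fun (s : S) => show φ 0 * (s : S) = 0 by rw [map_zero, zero_mul]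

instance : Module Sᵐᵒᵖ (BiTwist φ) where
  smul b s := of φ ((of φ).symm s * φ (unop b))
  one_smul := fun (s : S) => show s * φ 1 = s by rw [map_one, mul_one]
  mul_smul a b := fun (s : S) => show s * φ (unop b * unop a) = s * φ (unop b) * φ (unop a) by
    rw [map_mul, mul_assoc]
  smul_zero a := show (0 : S) * φ (unop a) = 0 from zero_mul _
  smul_add a := fun (s t : S) => show (s + t) * φ (unop a) = s * φ (unop a) + t * φ (unop a) from
    add_mul _ _ _
  add_smul a b := fun (s : S) => show s * φ (unop a + unop b) = s * φ (unop a) + s * φ (unop b) by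
    rw [map_add, mul_add]
  zero_smul := fun (s : S) => show s * φ 0 = 0 by rw [map_zero, mul_zero]

theorem smul_of (a s : S) : a • of φ s = of φ (φ a * s) := rfl

theorem op_smul_of (b s : S) : op b • of φ s = of φ (s * φ b) := rfl

instance : SMulCommClass S Sᵐᵒᵖ (BiTwist φ) where
  smul_comm a b := fun (s : S) =>
    show φ a * (s * φ (unop b)) = φ a * s * φ (unop b) from (mul_assoc _ _ _).symm

end BiTwist

namespace Bimodule

/-- An `S`-bimodule `M` is finitely generated: there is a finite subset of `M` such that the only
sub-bimodule of `M` containing it is `M`. -/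
def FG (S M : Type*) [Ring S] [AddCommGroup M] [Module S M] [Module Sᵐᵒᵖ M]
    [SMulCommClass S Sᵐᵒᵖ M] : Prop :=
  ∃ G : Finset M, ∀ N : AddSubgroup M, (∀ g ∈ G, g ∈ N) →
    (∀ (s : S), ∀ m ∈ N, s • m ∈ N) → (∀ (s : S), ∀ m ∈ N, op s • m ∈ N) → N = ⊤

variable {R S : Type*} [CommRing R] [Ring S] [Algebra R S] (C : Subalgebra R S)
  (M : Type*) [AddCommGroup M] [Module S M] [Module Sᵐᵒᵖ M] [SMulCommClass S Sᵐᵒᵖ M]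

/-- An `S`-bimodule `M` is `C`-linear if `c m = m c` for all `c ∈ C` and `m ∈ M`. -/
def IsLinearOver : Prop := ∀ c ∈ C, ∀ m : M, c • m = op c • m

/-- The invariants `M^S = {m ∈ M | s m = m s for all s ∈ S}` of an `S`-bimodule `M`, as a module
over a central subalgebra `C` of `S`. -/
def invariants (hC : C ≤ Subalgebra.center R S) : Submodule C M where
  carrier := {m | ∀ s : S, s • m = op s • m}
  zero_mem' s := by rw [smul_zero, smul_zero]
  add_mem' {a b} ha hb s := by rw [smul_add, smul_add, ha s, hb s]
  smul_mem' c m hm s := by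
    change s • ((c : S) • m) = op s • ((c : S) • m)
    rw [← smul_comm (c : S) (op s) m, ← hm s, ← mul_smul, ← mul_smul,
      Subalgebra.mem_center_iff.1 (hC c.2) s]

end Bimodule

/-! Write C for the subalgebra of p-th powers, and call `f`, `g` a Weyl pair if they satisfy the
relations of the Weyl algebra. Bracketing with `g i` and with `-f i` acts on ordered polynomials in
`f`, `g` as the partial derivatives. On exponents below p these derivatives recover every
coefficient, since 1, …, p - 1 are units. Hence a combination of restricted monomials (all exponents
below p) lies in a two-sided ideal only if its coefficients do (`smul_one_mem_of_sum_mem`).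

For x, ∂ this shows that A is free over C on the restricted monomials. For any other Weyl pair in A,
reduction modulo the maximal ideals of C shows that the matrix of its restricted monomials is
invertible, so these form a basis too (`exists_basis_of_basis`). Only elements of C commute with the
whole pair; this gives φ(C) ⊂ C and the invariants.

Finally φ carries the basis from x, ∂ to the basis from φ(x), φ(∂), so in coordinates it is φ|_C on
each copy of C (`repr_map`). As 1 is a basis vector, bijectivity and finite generation pass between
A and C. -/

namespace MvPolynomial

/-! ### Recovering coefficients from partial derivatives. -/

variable {ι k M : Type*} [CommRing k] [AddCommGroup M] [Module k M]

theorem add_single_mem_support_of_mem_support_pderiv {P : MvPolynomial ι k} {i : ι} {m : ι →₀ ℕ}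
    (hm : m ∈ (pderiv i P).support) : m + Finsupp.single i 1 ∈ P.support := by
  rw [mem_support_iff, coeff_pderiv] at hm
  rw [mem_support_iff]
  exact fun h0 => hm (by rw [h0, zero_mul])

theorem lt_of_mem_support_pderiv {P : MvPolynomial ι k} {p : ℕ}
    (hP : ∀ m ∈ P.support, ∀ i, m i < p) (i : ι) : ∀ m ∈ (pderiv i P).support, ∀ j, m j < p := by
  intro m hm j
  have := hP _ (add_single_mem_support_of_mem_support_pderiv hm) j
  rw [Finsupp.add_apply] at this
  omega

/-- For polynomials of degree `< p` in each variable, where `1, …, p - 1` are invertible, the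
nonconstant coefficients are controlled by those of the partial derivatives. -/
theorem coeff_smul_mem_of_pderiv {N : Submodule k M} {v : M} {p : ℕ}
    (hk : ∀ j : ℕ, 0 < j → j < p → IsUnit (j : k)) {P : MvPolynomial ι k}
    (hP : ∀ m ∈ P.support, ∀ i, m i < p) (h : ∀ i m, (pderiv i P).coeff m • v ∈ N)
    {m : ι →₀ ℕ} (hm : m ≠ 0) : P.coeff m • v ∈ N := by
  obtain ⟨i, hi⟩ : ∃ i, m i ≠ 0 := by
    by_contra! h0
    exact hm (Finsupp.ext h0)
  by_cases hms : m ∈ P.support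
  swap
  · rw [notMem_support_iff.1 hms, zero_smul]; exact N.zero_mem
  -- This coefficient of the derivative is `m i` times that of `P` at `m`, and `m i` is a unit.
  have h1 := h i (m - Finsupp.single i 1)
  have hm1 : m - Finsupp.single i 1 + Finsupp.single i 1 = m :=
    tsub_add_cancel_of_le (Finsupp.single_le_iff.2 (Nat.one_le_iff_ne_zero.2 hi))
  have h2 : (((m - Finsupp.single i 1 : ι →₀ ℕ) i : ℕ) : k) + 1 = (m i : ℕ) := by
    conv_rhs => rw [← hm1, Finsupp.add_apply, Finsupp.single_eq_same]
    push_cast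
    rfl
  rw [coeff_pderiv, hm1, h2] at h1
  obtain ⟨u, hu⟩ := hk (m i) (Nat.pos_of_ne_zero hi) (hP m hms i)
  have h3 := N.smul_mem (↑u⁻¹ : k) h1
  rwa [smul_smul, ← hu, mul_comm, mul_assoc, Units.mul_inv, mul_one] at h3

/-- A linear map on polynomials that intertwines the partial derivatives with operators preserving a
submodule `N` sends a polynomial of degree `< p` in each variable into `N` only if the coefficients
do so. -/
theorem coeff_smul_map_one_mem (Ψ : MvPolynomial ι k →ₗ[k] M) (δ : ι → M →ₗ[k] M)
    (hδ : ∀ i P, δ i (Ψ P) = Ψ (pderiv i P)) (N : Submodule k M)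
    (hN : ∀ i, ∀ s ∈ N, δ i s ∈ N)
    (hE : ∀ (c : k) m, c • Ψ 1 ∈ N → c • Ψ (monomial m 1) ∈ N) {p : ℕ}
    (hk : ∀ j : ℕ, 0 < j → j < p → IsUnit (j : k)) (P : MvPolynomial ι k)
    (hP : ∀ m ∈ P.support, ∀ i, m i < p) (h : Ψ P ∈ N) (m : ι →₀ ℕ) :
    P.coeff m • Ψ 1 ∈ N := by
  classical
  -- The bound is strict, so that `d = 0` forces `P = 0`; each derivative lowers it by one.
  obtain ⟨d, hd⟩ : ∃ d, ∀ m ∈ P.support, m.degree < d :=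
    ⟨P.support.sup Finsupp.degree + 1, fun m hm => Nat.lt_succ_of_le (Finset.le_sup hm)⟩
  induction d generalizing P m with
  | zero =>
    by_cases hm : m ∈ P.support
    · exact absurd (hd m hm) (Nat.not_lt_zero _)
    · rw [notMem_support_iff.1 hm, zero_smul]; exact N.zero_mem
  | succ d ih =>
    have key : ∀ m, m ≠ 0 → P.coeff m • Ψ 1 ∈ N := fun m hm =>
      coeff_smul_mem_of_pderiv hk hP (fun i m' => ih _ (lt_of_mem_support_pderiv hP i)
        (hδ i P ▸ hN i _ h) m' (fun l hl => by
          have := hd _ (add_single_mem_support_of_mem_support_pderiv hl)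
          rw [map_add, Finsupp.degree_single] at this
          omega)) hm
    by_cases hm : m = 0
    · subst hm
      -- The constant coefficient is what remains of `Ψ P` after removing the other terms, which
      -- `hE` places in `N`.
      have hsum : Ψ P = P.coeff 0 • Ψ 1 +
          ∑ m ∈ P.support.erase 0, P.coeff m • Ψ (monomial m 1) := by
        have e : Ψ P = ∑ m ∈ P.support, P.coeff m • Ψ (monomial m 1) := by
          conv_lhs => rw [P.as_sum, map_sum]
          refine Finset.sum_congr rfl fun m _ => ?_
          rw [← map_smul, smul_monomial, smul_eq_mul, mul_one]
        rw [e]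
        by_cases h0 : (0 : ι →₀ ℕ) ∈ P.support
        · rw [← Finset.add_sum_erase _ _ h0]; rfl
        · rw [Finset.erase_eq_of_notMem h0, notMem_support_iff.1 h0, zero_smul, zero_add]
      rw [hsum] at h
      exact (N.add_mem_iff_left (N.sum_mem fun m hm =>
        hE _ _ (key m (Finset.ne_of_mem_erase hm)))).1 h
    · exact key m hm

theorem pderiv_monomial_one (i : ι) (m : ι →₀ ℕ) :
    pderiv i (monomial m (1 : k)) = (m i : k) • monomial (m - Finsupp.single i 1) 1 := by
  rw [pderiv_monomial, smul_monomial, smul_eq_mul, one_mul, mul_one]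

end MvPolynomial

/-! ### Weyl pairs: commutators as partial derivatives. -/

/-- Families `f` and `g` in a ring that satisfy the relations of the Weyl algebra. -/
structure IsWeylPair {σ A : Type*} [DecidableEq σ] [Ring A] (f g : σ → A) : Prop where
  comm_left : ∀ i j, Commute (f i) (f j)
  comm_right : ∀ i j, Commute (g i) (g j)
  commutator : ∀ i j, g i * f j - f j * g i = if i = j then 1 else 0

namespace IsWeylPair

section

variable {σ A : Type*} (k : Type*) [CommRing k] [Ring A] [Algebra k A]

/-- Evaluation of polynomials at a commuting family of elements of a noncommutative algebra. -/
noncomputable def commAeval (f : σ → A) (hf : ∀ i j, Commute (f i) (f j)) :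
    MvPolynomial σ k →ₐ[k] A :=
  -- `MvPolynomial.aeval` needs a commutative target; the subalgebra generated by the family is one.
  letI : CommRing (Algebra.adjoin k (Set.range f)) :=
    { (inferInstance : Ring (Algebra.adjoin k (Set.range f))) with
      mul_comm := (Algebra.isMulCommutative_adjoin k (by
        rintro _ ⟨i, rfl⟩ _ ⟨j, rfl⟩
        exact hf i j)).is_comm.comm }
  (Algebra.adjoin k (Set.range f)).val.comp
    (MvPolynomial.aeval fun i => (⟨f i, Algebra.subset_adjoin ⟨i, rfl⟩⟩ :
      Algebra.adjoin k (Set.range f)))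

theorem commAeval_X (f : σ → A) (hf : ∀ i j, Commute (f i) (f j)) (i : σ) :
    commAeval k f hf (MvPolynomial.X i) = f i := by
  simp [commAeval]

variable {k}

/-- If `[a, f i] = δ i j` then the commutator with `a` acts as the `j`-th partial derivative on
polynomials in `f`. -/
theorem commutator_commAeval [DecidableEq σ] {f : σ → A} (hf : ∀ i j, Commute (f i) (f j)) {a : A}
    {j : σ} (ha : ∀ i, a * f i - f i * a = if j = i then 1 else 0) (P : MvPolynomial σ k) :
    a * commAeval k f hf P - commAeval k f hf P * a
      = commAeval k f hf (MvPolynomial.pderiv j P) := by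
  induction P using MvPolynomial.induction_on with
  | C r =>
    rw [MvPolynomial.pderiv_C, map_zero, ← MvPolynomial.algebraMap_eq, AlgHom.commutes,
      Algebra.commutes, sub_self]
  | add P Q hP hQ =>
    rw [map_add, map_add, map_add, ← hP, ← hQ]; noncomm_ring
  | mul_X P i hP =>
    have hX : commAeval k f hf (MvPolynomial.pderiv j (MvPolynomial.X i)) = a * f i - f i * a := by
      rw [ha, MvPolynomial.pderiv_X, Pi.single_apply]
      simp only [eq_comm (a := i)]
      split_ifs <;> simp
    rw [Derivation.leibniz, smul_eq_mul, smul_eq_mul, mul_comm (MvPolynomial.X i), map_add,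
      map_mul, map_mul, map_mul, commAeval_X, hX, ← hP]
    noncomm_ring

theorem commute_commAeval {f : σ → A} (hf : ∀ i j, Commute (f i) (f j)) {a : A}
    (ha : ∀ i, Commute a (f i)) (P : MvPolynomial σ k) : Commute a (commAeval k f hf P) := by
  induction P using MvPolynomial.induction_on with
  | C r =>
    rw [← MvPolynomial.algebraMap_eq, AlgHom.commutes]
    exact (Algebra.commutes r a).symm
  | add P Q hP hQ => rw [map_add]; exact hP.add_right hQ
  | mul_X P i hP => rw [map_mul, commAeval_X]; exact hP.mul_right (ha i)

end

end IsWeylPair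

namespace IsWeylPair

section

variable {σ A : Type*} (k : Type*) [CommRing k] [Ring A] [Algebra k A] {f g : σ → A}

/-- The inner derivations that act on ordered polynomials in `f`, `g` as partial derivatives. -/
noncomputable def derivation : σ ⊕ σ → A →ₗ[k] A
  | Sum.inl i => LinearMap.mulLeft k (g i) - LinearMap.mulRight k (g i)
  | Sum.inr i => LinearMap.mulRight k (f i) - LinearMap.mulLeft k (f i)

theorem derivation_inl (i : σ) (s : A) :
    derivation k (f := f) (g := g) (Sum.inl i) s = g i * s - s * g i := rfl

theorem derivation_inr (i : σ) (s : A) :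
    derivation k (f := f) (g := g) (Sum.inr i) s = s * f i - f i * s := rfl

end

variable {σ A : Type*} [DecidableEq σ] (k : Type*) [CommRing k] [Ring A] [Algebra k A]
  {f g : σ → A} (h : IsWeylPair f g)

/-- The linear map sending the monomial with exponents `(a, b)` to `f ^ a * g ^ b`. -/
noncomputable def orderedMap : MvPolynomial (σ ⊕ σ) k →ₗ[k] A :=
  (MvPolynomial.basisMonomials _ k).constr k fun m =>
    commAeval k f h.comm_left
        (MvPolynomial.monomial (m.comapDomain Sum.inl Sum.inl_injective.injOn) 1) *
      commAeval k g h.comm_right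
        (MvPolynomial.monomial (m.comapDomain Sum.inr Sum.inr_injective.injOn) 1)

theorem orderedMap_monomial (m : σ ⊕ σ →₀ ℕ) :
    h.orderedMap k (MvPolynomial.monomial m 1) = commAeval k f h.comm_left
        (MvPolynomial.monomial (m.comapDomain Sum.inl Sum.inl_injective.injOn) 1) *
      commAeval k g h.comm_right
        (MvPolynomial.monomial (m.comapDomain Sum.inr Sum.inr_injective.injOn) 1) := by
  have e := (MvPolynomial.basisMonomials (σ ⊕ σ) k).constr_basis k (fun m =>
    commAeval k f h.comm_left
        (MvPolynomial.monomial (m.comapDomain Sum.inl Sum.inl_injective.injOn) 1) *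
      commAeval k g h.comm_right
        (MvPolynomial.monomial (m.comapDomain Sum.inr Sum.inr_injective.injOn) 1)) m
  rwa [MvPolynomial.coe_basisMonomials] at e

theorem orderedMap_one : h.orderedMap k 1 = 1 := by
  have e := h.orderedMap_monomial k 0
  have h0 : ∀ (i : σ → σ ⊕ σ) (hi : Set.InjOn i (i ⁻¹' ((0 : σ ⊕ σ →₀ ℕ).support : Set (σ ⊕ σ)))),
    Finsupp.comapDomain i (0 : σ ⊕ σ →₀ ℕ) hi = 0 := fun i hi => by ext; simp
  rw [h0, h0] at e
  simpa using e

/-- In `f ^ a * g ^ b`, bracketing with `g j` ignores the right factor and bracketing with `f j`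
ignores the left one, so the Leibniz rule leaves a single term. -/
theorem derivation_orderedMap (i : σ ⊕ σ) (P : MvPolynomial (σ ⊕ σ) k) :
    derivation k (f := f) (g := g) i (h.orderedMap k P)
      = h.orderedMap k (MvPolynomial.pderiv i P) := by
  have key : derivation k (f := f) (g := g) i ∘ₗ h.orderedMap k
      = h.orderedMap k ∘ₗ (MvPolynomial.pderiv i).toLinearMap := by
    refine (MvPolynomial.basisMonomials _ k).ext fun m => ?_
    rw [MvPolynomial.coe_basisMonomials, LinearMap.comp_apply, LinearMap.comp_apply,
      orderedMap_monomial, Derivation.coeFn_coe,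
      MvPolynomial.pderiv_monomial_one, map_smul, orderedMap_monomial]
    rcases i with j | j
    · have e1 : (m - Finsupp.single (Sum.inl j) 1).comapDomain Sum.inl Sum.inl_injective.injOn
          = m.comapDomain Sum.inl Sum.inl_injective.injOn - Finsupp.single j 1 := by
        ext l; simp [Finsupp.single_apply]
      have e2 : (m - Finsupp.single (Sum.inl j) 1).comapDomain Sum.inr Sum.inr_injective.injOn
          = m.comapDomain Sum.inr Sum.inr_injective.injOn := by
        ext l; simp
      have e3 := commutator_commAeval h.comm_left (h.commutator j)
        (MvPolynomial.monomial (m.comapDomain Sum.inl Sum.inl_injective.injOn) (1 : k))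
      have e4 := commute_commAeval h.comm_right (h.comm_right j)
        (MvPolynomial.monomial (m.comapDomain Sum.inr Sum.inr_injective.injOn) (1 : k))
      rw [MvPolynomial.pderiv_monomial_one, map_smul] at e3
      rw [derivation_inl, e1, e2, mul_assoc, ← e4.eq, ← mul_assoc, ← mul_assoc, ← sub_mul, e3,
        smul_mul_assoc]
      rfl
    · have e1 : (m - Finsupp.single (Sum.inr j) 1).comapDomain Sum.inr Sum.inr_injective.injOn
          = m.comapDomain Sum.inr Sum.inr_injective.injOn - Finsupp.single j 1 := by
        ext l; simp [Finsupp.single_apply]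
      have e2 : (m - Finsupp.single (Sum.inr j) 1).comapDomain Sum.inl Sum.inl_injective.injOn
          = m.comapDomain Sum.inl Sum.inl_injective.injOn := by
        ext l; simp
      -- The roles are exchanged with a sign: `[-f j, g i] = [g i, f j]`.
      have e3 := commutator_commAeval h.comm_right (a := -f j) (j := j)
        (fun i => by
          rw [neg_mul, mul_neg, sub_neg_eq_add, neg_add_eq_sub, h.commutator]
          simp only [eq_comm])
        (MvPolynomial.monomial (m.comapDomain Sum.inr Sum.inr_injective.injOn) (1 : k))
      have e4 := commute_commAeval h.comm_left (h.comm_left j)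
        (MvPolynomial.monomial (m.comapDomain Sum.inl Sum.inl_injective.injOn) (1 : k))
      rw [MvPolynomial.pderiv_monomial_one, map_smul, neg_mul, mul_neg, sub_neg_eq_add,
        neg_add_eq_sub] at e3
      rw [derivation_inr, e1, e2, ← mul_assoc, e4.eq, mul_assoc, mul_assoc, ← mul_sub, e3,
        mul_smul_comm]
      rfl
  exact LinearMap.congr_fun key P

end IsWeylPair

/-! ### Restricted monomials: independence, centralizer, span and change of basis. -/

namespace IsWeylPair

variable {σ A : Type*} [DecidableEq σ] [Fintype σ] (k : Type*) [CommRing k] [Ring A] [Algebra k A]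
  {f g : σ → A} (h : IsWeylPair f g) (p : ℕ)

/-- The ordered monomials in `f` and `g` with all exponents less than `p`. -/
noncomputable def restrictedMonomial (m : σ ⊕ σ → Fin p) : A :=
  h.orderedMap k
    (MvPolynomial.monomial (Finsupp.equivFunOnFinite.symm fun i => (m i : ℕ)) 1)

/-- The polynomial with prescribed coefficients at the monomials of degree `< p` in each variable. -/
noncomputable def restrictedPolynomial {p : ℕ} (c : (σ ⊕ σ → Fin p) → k) :
    MvPolynomial (σ ⊕ σ) k :=
  ∑ m, MvPolynomial.monomial (Finsupp.equivFunOnFinite.symm fun i => (m i : ℕ)) (c m)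

variable {k p}

theorem coeff_restrictedPolynomial (c : (σ ⊕ σ → Fin p) → k) (m : σ ⊕ σ → Fin p) :
    (restrictedPolynomial k c).coeff (Finsupp.equivFunOnFinite.symm fun i => (m i : ℕ)) = c m := by
  classical
  rw [restrictedPolynomial, MvPolynomial.coeff_sum, Finset.sum_eq_single m]
  · rw [MvPolynomial.coeff_monomial, if_pos rfl]
  · intro m' _ hm'
    rw [MvPolynomial.coeff_monomial, if_neg]
    intro e
    refine hm' (funext fun i => Fin.ext ?_)
    exact congrFun (Finsupp.equivFunOnFinite.symm.injective e) i
  · exact fun hm => absurd (Finset.mem_univ _) hm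

theorem lt_of_mem_support_restrictedPolynomial (c : (σ ⊕ σ → Fin p) → k) :
    ∀ m ∈ (restrictedPolynomial k c).support, ∀ i, m i < p := by
  classical
  intro m hm i
  obtain ⟨m', -, hm'⟩ := Finset.mem_biUnion.1 (MvPolynomial.support_sum hm)
  rw [MvPolynomial.support_monomial] at hm'
  split_ifs at hm'
  · simp at hm'
  · rw [Finset.mem_singleton.1 hm']
    exact (m' i).2

theorem orderedMap_restrictedPolynomial (c : (σ ⊕ σ → Fin p) → k) :
    h.orderedMap k (restrictedPolynomial k c) = ∑ m, c m • h.restrictedMonomial k p m := by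
  rw [restrictedPolynomial, map_sum]
  refine Finset.sum_congr rfl fun m _ => ?_
  rw [restrictedMonomial, ← map_smul, MvPolynomial.smul_monomial, smul_eq_mul, mul_one]

/-- Restricted monomials are linearly independent modulo any two-sided ideal, as far as the
constants are. -/
theorem smul_one_mem_of_sum_mem (hk : ∀ j : ℕ, 0 < j → j < p → IsUnit (j : k))
    (N : Submodule k A) (hl : ∀ a, ∀ s ∈ N, a * s ∈ N) (hr : ∀ a, ∀ s ∈ N, s * a ∈ N)
    {c : (σ ⊕ σ → Fin p) → k} (hc : ∑ m, c m • h.restrictedMonomial k p m ∈ N)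
    (m : σ ⊕ σ → Fin p) : c m • (1 : A) ∈ N := by
  rw [← orderedMap_restrictedPolynomial] at hc
  have := MvPolynomial.coeff_smul_map_one_mem (h.orderedMap k) (derivation k (f := f) (g := g))
    (h.derivation_orderedMap k) N
    (by
      rintro (i | i) s hs
      · exact N.sub_mem (hl _ _ hs) (hr _ _ hs)
      · exact N.sub_mem (hr _ _ hs) (hl _ _ hs))
    (by
      intro r m' hr'
      rw [orderedMap_one] at hr'
      -- A multiple of 1 in `N`, multiplied by any element, stays in `N`.
      have := hr (h.orderedMap k (MvPolynomial.monomial m' 1)) _ hr'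
      rwa [smul_one_mul] at this)
    hk _ (lt_of_mem_support_restrictedPolynomial c) hc
    (Finsupp.equivFunOnFinite.symm fun i => (m i : ℕ))
  rwa [coeff_restrictedPolynomial, orderedMap_one] at this

theorem linearIndependent_restrictedMonomial (hk : ∀ j : ℕ, 0 < j → j < p → IsUnit (j : k))
    (hinj : Function.Injective (algebraMap k A)) :
    LinearIndependent k (h.restrictedMonomial k p) := by
  rw [Fintype.linearIndependent_iff]
  intro c hc m
  have := h.smul_one_mem_of_sum_mem hk ⊥ (fun a s hs => by simp_all) (fun a s hs => by simp_all)
    (c := c) (by simpa using hc) m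
  rw [Submodule.mem_bot, ← Algebra.algebraMap_eq_smul_one] at this
  exact (map_eq_zero_iff _ hinj).1 this

theorem restrictedMonomial_zero [NeZero p] : h.restrictedMonomial k p 0 = 1 := by
  rw [restrictedMonomial, ← h.orderedMap_one k]
  congr 1
  rw [← MvPolynomial.C_1, ← MvPolynomial.monomial_zero']
  congr 2
  ext i
  simp

/-- Constants are the only elements of the span of the restricted monomials that commute with `f`
and `g`. -/
theorem mem_range_algebraMap_of_commute [NeZero p]
    (hk : ∀ j : ℕ, 0 < j → j < p → IsUnit (j : k))
    (hinj : Function.Injective (algebraMap k A)) {z : A}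
    (hz : z ∈ Submodule.span k (Set.range (h.restrictedMonomial k p)))
    (hf : ∀ i, Commute (f i) z) (hg : ∀ i, Commute (g i) z) :
    z ∈ Set.range (algebraMap k A) := by
  obtain ⟨c, rfl⟩ := (Submodule.mem_span_range_iff_exists_fun k).1 hz
  have hδ : ∀ i, h.orderedMap k (MvPolynomial.pderiv i (restrictedPolynomial k c)) = 0 := by
    intro i
    rw [← derivation_orderedMap, orderedMap_restrictedPolynomial]
    rcases i with i | i
    · rw [derivation_inl, (hg i).eq, sub_self]
    · rw [derivation_inr, (hf i).eq, sub_self]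
  -- All partial derivatives map to 0, so their coefficients vanish, and with them the nonconstant
  -- coefficients `c m`.
  have h0 : ∀ m, m ≠ 0 → c m = 0 := by
    intro m hm
    have := MvPolynomial.coeff_smul_mem_of_pderiv (N := (⊥ : Submodule k A)) (v := 1) hk
      (lt_of_mem_support_restrictedPolynomial c) (fun i m' => ?_)
      (m := Finsupp.equivFunOnFinite.symm fun i => (m i : ℕ)) (fun e => ?_)
    · rw [coeff_restrictedPolynomial, Submodule.mem_bot, ← Algebra.algebraMap_eq_smul_one] at this
      exact (map_eq_zero_iff _ hinj).1 this
    · rw [← h.orderedMap_one k]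
      refine MvPolynomial.coeff_smul_map_one_mem (h.orderedMap k)
        (derivation k (f := f) (g := g)) (h.derivation_orderedMap k) ⊥ (fun i s hs => ?_)
        (fun r l hr => ?_) hk _
        (MvPolynomial.lt_of_mem_support_pderiv (lt_of_mem_support_restrictedPolynomial c) i)
        ((Submodule.mem_bot k).2 (hδ i)) m'
      · rw [(Submodule.mem_bot k).1 hs, map_zero]; exact Submodule.zero_mem _
      · rw [orderedMap_one, Submodule.mem_bot] at hr
        rw [Submodule.mem_bot, ← smul_one_mul, hr, zero_mul]
    · refine hm (funext fun i => Fin.ext ?_)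
      have := DFunLike.congr_fun e i
      simpa using this
  refine ⟨c 0, ?_⟩
  rw [Finset.sum_eq_single 0 (fun m _ hm => by rw [h0 m hm, zero_smul])
    (fun hm => absurd (Finset.mem_univ _) hm), restrictedMonomial_zero,
    Algebra.algebraMap_eq_smul_one]

/-- If `f ^ p` and `g ^ p` are constants and `f` and `g` generate, then the restricted monomials
span. -/
theorem span_restrictedMonomial [NeZero p] (hfp : ∀ i, f i ^ p ∈ (algebraMap k A).range)
    (hgp : ∀ i, g i ^ p ∈ (algebraMap k A).range)
    (hgen : Algebra.adjoin k (Set.range f ∪ Set.range g) = ⊤) :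
    Submodule.span k (Set.range (h.restrictedMonomial k p)) = ⊤ := by
  have hpow : ∀ {e : σ → A} (he : ∀ i j, Commute (e i) (e j)),
      (∀ i, e i ^ p ∈ (algebraMap k A).range) → ∀ q : σ →₀ ℕ,
      ∃ r, commAeval k e he (MvPolynomial.monomial (p • q) 1) = algebraMap k A r := by
    intro e he hep q
    suffices commAeval k e he (MvPolynomial.monomial (p • q) 1) ∈ (algebraMap k A).range by
      obtain ⟨r, hr⟩ := this
      exact ⟨r, hr.symm⟩
    induction q using Finsupp.induction_linear with
    | zero => rw [smul_zero]; exact (map_one (commAeval k e he)) ▸ Subring.one_mem _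
    | add q q' hq hq' =>
      rw [smul_add, ← one_mul (1 : k), ← MvPolynomial.monomial_mul, map_mul]
      exact Subring.mul_mem _ hq hq'
    | single i j =>
      rw [Finsupp.smul_single, smul_eq_mul, ← MvPolynomial.X_pow_eq_monomial, map_pow,
        commAeval_X, pow_mul]
      exact Subring.pow_mem _ (hep i) j
  -- Division of each exponent by `p` splits off a constant.
  have hred : ∀ {e : σ → A} (he : ∀ i j, Commute (e i) (e j)),
      (∀ i, e i ^ p ∈ (algebraMap k A).range) → ∀ q : σ →₀ ℕ, ∃ r : k,
      commAeval k e he (MvPolynomial.monomial q 1) = r • commAeval k e he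
        (MvPolynomial.monomial (Finsupp.equivFunOnFinite.symm fun i => q i % p) 1) := by
    intro e he hep q
    obtain ⟨r, hr⟩ := hpow he hep (Finsupp.equivFunOnFinite.symm fun i => q i / p)
    refine ⟨r, ?_⟩
    rw [Algebra.smul_def, ← hr, ← map_mul, MvPolynomial.monomial_mul, one_mul]
    refine congrArg (fun l => commAeval k e he (MvPolynomial.monomial l 1)) (Finsupp.ext fun i => ?_)
    simp [Nat.div_add_mod]
  set W := Submodule.span k (Set.range (h.restrictedMonomial k p))
  have hmem : ∀ P Q, commAeval k f h.comm_left P * commAeval k g h.comm_right Q ∈ W := by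
    intro P Q
    induction P using MvPolynomial.induction_on' with
    | add P P' hP hP' => rw [map_add, add_mul]; exact W.add_mem hP hP'
    | monomial a r =>
    induction Q using MvPolynomial.induction_on' with
    | add Q Q' hQ hQ' => rw [map_add, mul_add]; exact W.add_mem hQ hQ'
    | monomial b t =>
    have hmon : ∀ (l : σ →₀ ℕ) (u : k),
        MvPolynomial.monomial l u = u • MvPolynomial.monomial l 1 := fun l u => by
      rw [MvPolynomial.smul_monomial, smul_eq_mul, mul_one]
    rw [hmon a, hmon b, map_smul, map_smul, smul_mul_smul_comm]
    obtain ⟨r', hr'⟩ := hred h.comm_left hfp a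
    obtain ⟨t', ht'⟩ := hred h.comm_right hgp b
    rw [hr', ht', smul_mul_smul_comm]
    refine W.smul_mem _ (W.smul_mem _ (Submodule.subset_span
      ⟨Sum.elim (fun i => Fin.ofNat p (a i)) (fun i => Fin.ofNat p (b i)), ?_⟩))
    rw [restrictedMonomial, orderedMap_monomial]
    congr 4 <;> ext i <;> simp
  have hgen_mul : ∀ {e : A}, (∀ P Q,
      e * (commAeval k f h.comm_left P * commAeval k g h.comm_right Q) ∈ W) →
      ∀ s ∈ W, e * s ∈ W := by
    intro e he s hs
    refine (Submodule.span_le (p := W.comap (LinearMap.mulLeft k e))).2 ?_ hs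
    rintro _ ⟨m, rfl⟩
    rw [restrictedMonomial, orderedMap_monomial]
    exact he _ _
  -- `W` is a left ideal containing 1; for `g i` the commutator moves it past the `f`-part at the
  -- cost of a derivative.
  have hmul : ∀ a : A, ∀ s ∈ W, a * s ∈ W := by
    intro a
    have ha : a ∈ Algebra.adjoin k (Set.range f ∪ Set.range g) := hgen ▸ Algebra.mem_top
    induction ha using Algebra.adjoin_induction with
    | mem y hy =>
      refine hgen_mul fun P Q => ?_
      rcases hy with ⟨i, rfl⟩ | ⟨i, rfl⟩
      · rw [← mul_assoc, ← commAeval_X k f h.comm_left i, ← map_mul]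
        exact hmem _ _
      · rw [← mul_assoc, ← sub_add_cancel (g i * commAeval k f h.comm_left P)
          (commAeval k f h.comm_left P * g i),
          commutator_commAeval h.comm_left (h.commutator i), add_mul, mul_assoc _ (g i)]
        refine W.add_mem (hmem _ _) ?_
        rw [← commAeval_X k g h.comm_right i, ← map_mul]
        exact hmem _ _
    | algebraMap r => exact fun s hs => by rw [← Algebra.smul_def]; exact W.smul_mem r hs
    | add y z _ _ hy hz => exact fun s hs => by rw [add_mul]; exact W.add_mem (hy s hs) (hz s hs)
    | mul y z _ _ hy hz => exact fun s hs => by rw [mul_assoc]; exact hy _ (hz s hs)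
  rw [eq_top_iff]
  intro a _
  have h1 : (1 : A) ∈ W := by simpa using hmem 1 1
  simpa using hmul a 1 h1

/-- If the restricted monomials of one Weyl pair form a basis, then so do those of any other. -/
theorem exists_basis_of_basis [NeZero p] (hk : ∀ j : ℕ, 0 < j → j < p → IsUnit (j : k))
    (b : Module.Basis (σ ⊕ σ → Fin p) k A) (hb : b 0 = 1) :
    ∃ b' : Module.Basis (σ ⊕ σ → Fin p) k A, ∀ m, b' m = h.restrictedMonomial k p m := by
  classical
  have hdet : IsUnit (b.det (h.restrictedMonomial k p)) := by
    -- A non-unit determinant vanishes modulo some maximal ideal `I`, where a kernel vector `w`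
    -- gives a nontrivial relation.
    by_contra hu
    obtain ⟨I, hI, hdI⟩ := exists_max_ideal_of_mem_nonunits hu
    let _ : Field (k ⧸ I) := Ideal.Quotient.field I
    set M := b.toMatrix (h.restrictedMonomial k p)
    have h0 : (M.map (Ideal.Quotient.mk I)).det = 0 := by
      rw [← RingHom.mapMatrix_apply, ← RingHom.map_det, Ideal.Quotient.eq_zero_iff_mem]
      exact hdI
    obtain ⟨w, hw0, hw⟩ := Matrix.exists_mulVec_eq_zero_iff.2 h0
    choose c hc using fun m => Ideal.Quotient.mk_surjective (I := I) (w m)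
    -- `I • ⊤` is stable under all linear maps, hence a two-sided ideal of `A`.
    have hstab : ∀ T : A →ₗ[k] A, ∀ s ∈ I • (⊤ : Submodule k A), T s ∈ I • (⊤ : Submodule k A) := by
      intro T s hs
      have := Submodule.mem_map_of_mem (f := T) hs
      rw [Submodule.map_smul''] at this
      exact Submodule.smul_mono le_rfl le_top this
    have hsum : ∑ m, c m • h.restrictedMonomial k p m ∈ I • (⊤ : Submodule k A) := by
      rw [← b.sum_repr (∑ m, c m • h.restrictedMonomial k p m)]
      refine Submodule.sum_mem _ fun l _ => Submodule.smul_mem_smul ?_ trivial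
      rw [← Ideal.Quotient.eq_zero_iff_mem, map_sum, Finsupp.finsetSum_apply, map_sum]
      refine Eq.trans (Finset.sum_congr rfl fun m _ => ?_) (congrFun hw l)
      rw [map_smul, Finsupp.smul_apply, smul_eq_mul, map_mul, hc, mul_comm]
      rfl
    refine hw0 (funext fun m => ?_)
    have h1 := h.smul_one_mem_of_sum_mem hk _ (fun a => hstab (LinearMap.mulLeft k a))
      (fun a => hstab (LinearMap.mulRight k a)) hsum m
    -- The coordinate along `b 0 = 1` sends `I • ⊤` into `I`, so `w m = 0`.
    have h2 := Submodule.mem_map_of_mem (f := b.coord 0) h1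
    have h3 : b.coord 0 (c m • (1 : A)) = c m := by
      rw [map_smul, ← hb, b.coord_apply, b.repr_self, Finsupp.single_eq_same, smul_eq_mul, mul_one]
    rw [Submodule.map_smul'', h3] at h2
    rw [← hc m]
    exact Ideal.Quotient.eq_zero_iff_mem.2
      ((Submodule.smul_le (P := I)).2 (fun r hr n _ => I.mul_mem_right n hr) h2)
  obtain ⟨hli, hsp⟩ := (Module.Basis.is_basis_iff_det b).2 hdet
  exact ⟨Module.Basis.mk hli hsp.ge, fun m => Module.Basis.mk_apply hli hsp.ge m⟩

end IsWeylPair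

/-! ### Images of Weyl pairs under ring homomorphisms. -/

namespace IsWeylPair

section

variable {σ A B : Type*} (k l : Type*) [CommRing k] [CommRing l] [Ring A] [Algebra k A]
  [Ring B] [Algebra l B]

theorem map_commAeval_monomial (ψ : A →+* B) {f : σ → A} {f' : σ → B}
    (hf : ∀ i j, Commute (f i) (f j)) (hf' : ∀ i j, Commute (f' i) (f' j))
    (h : ∀ i, ψ (f i) = f' i) (m : σ →₀ ℕ) :
    ψ (commAeval k f hf (MvPolynomial.monomial m 1))
      = commAeval l f' hf' (MvPolynomial.monomial m 1) := by
  induction m using Finsupp.induction_linear with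
  | zero =>
    exact (congrArg ψ (map_one (commAeval k f hf))).trans
      ((map_one ψ).trans (map_one (commAeval l f' hf')).symm)
  | add m m' hm hm' =>
    rw [← one_mul (1 : k), ← one_mul (1 : l), ← MvPolynomial.monomial_mul,
      ← MvPolynomial.monomial_mul, map_mul, map_mul, map_mul, hm, hm']
  | single i j =>
    rw [← MvPolynomial.X_pow_eq_monomial, ← MvPolynomial.X_pow_eq_monomial, map_pow, map_pow,
      map_pow, commAeval_X, commAeval_X, h]

end

variable {σ A B : Type*} [DecidableEq σ] [Ring A] [Ring B] {f g : σ → A}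

theorem map (h : IsWeylPair f g) (ψ : A →+* B) :
    IsWeylPair (fun i => ψ (f i)) (fun i => ψ (g i)) where
  comm_left i j := (h.comm_left i j).map ψ
  comm_right i j := (h.comm_right i j).map ψ
  commutator i j := by
    rw [← map_mul, ← map_mul, ← map_sub, h.commutator]
    split_ifs <;> simp

theorem map_restrictedMonomial [Fintype σ] (k l : Type*) [CommRing k] [CommRing l] [Algebra k A] [Algebra l B]
    (h : IsWeylPair f g) (ψ : A →+* B) (p : ℕ) (m : σ ⊕ σ → Fin p) :
    ψ (h.restrictedMonomial k p m) = (h.map ψ).restrictedMonomial l p m := by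
  rw [restrictedMonomial, restrictedMonomial, orderedMap_monomial, orderedMap_monomial, map_mul,
    map_commAeval_monomial k l ψ h.comm_left (h.map ψ).comm_left (fun _ => rfl),
    map_commAeval_monomial k l ψ h.comm_right (h.map ψ).comm_right (fun _ => rfl)]

end IsWeylPair

theorem isUnit_natCast_of_lt_prime {k : Type*} [CommRing k] {p : ℕ} (hp : p.Prime)
    (h0 : (p : k) = 0) (j : ℕ) (hj : 0 < j) (hjp : j < p) : IsUnit (j : k) := by
  have hc : IsCoprime (j : ℤ) (p : ℤ) :=
    Nat.isCoprime_iff_coprime.2 ((hp.coprime_iff_not_dvd.2 (Nat.not_dvd_of_pos_of_lt hj hjp)).symm)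
  obtain ⟨u, v, huv⟩ := hc
  have := congrArg (Int.cast : ℤ → k) huv
  push_cast at this
  rw [h0, mul_zero, add_zero] at this
  exact IsUnit.of_mul_eq_one_right _ this

/-! ### Bases of the Weyl algebra over the p-th powers. -/

namespace WeylAlgebra

variable {R : Type*} [CommRing R] {n : ℕ} {p : ℕ}

theorem isWeylPair : IsWeylPair (x R n) (d R n) :=
  ⟨x_comm R n, d_comm R n, d_mul_x R n⟩

theorem pPowers_smul_def (c : pPowers R n p) (a : WeylAlgebra R n) : c • a = c * a := rfl

theorem restrict_coe {φ : WeylAlgebra R n →ₐ[R] WeylAlgebra R n}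
    (h : ∀ c ∈ pPowers R n p, φ c ∈ pPowers R n p) (c : pPowers R n p) :
    (restrict φ h c : WeylAlgebra R n) = φ c := rfl

/-- When 1 is a basis vector, its coordinate is a retraction of A onto C. -/
theorem repr_coe {ι : Type*}
    {b : Module.Basis ι (pPowers R n p) (WeylAlgebra R n)} {i₀ : ι} (h0 : b i₀ = 1) (c : pPowers R n p) :
    b.repr (c : WeylAlgebra R n) i₀ = c := by
  have : (c : WeylAlgebra R n) = c • b i₀ := by rw [h0, pPowers_smul_def, mul_one]
  rw [this, map_smul, b.repr_self, Finsupp.smul_apply, Finsupp.single_eq_same, smul_eq_mul, mul_one]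

/-- φ is semilinear over φ|_C, so it acts on coordinates through φ|_C. -/
theorem repr_map {ι : Type*} [Fintype ι]
    {b b' : Module.Basis ι (pPowers R n p) (WeylAlgebra R n)}
    {φ : WeylAlgebra R n →ₐ[R] WeylAlgebra R n} (h : ∀ c ∈ pPowers R n p, φ c ∈ pPowers R n p) (hb : ∀ i, φ (b i) = b' i)
    (a : WeylAlgebra R n) (i : ι) : b'.repr (φ a) i = restrict φ h (b.repr a i) := by
  have e : φ a = ∑ i, restrict φ h (b.repr a i) • b' i := by
    conv_lhs => rw [← b.sum_repr a, map_sum]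
    refine Finset.sum_congr rfl fun i _ => ?_
    rw [pPowers_smul_def, map_mul, pPowers_smul_def, hb, restrict_coe]
  rw [e, b'.repr_sum_self]

variable [CharP R p]

noncomputable instance : Algebra (pPowers R n p) (WeylAlgebra R n) where
  smul c a := (c : WeylAlgebra R n) • a
  algebraMap := (pPowers R n p).val.toRingHom
  commutes' c a := (Subalgebra.mem_center_iff.1 (pPowers_le_center R n p c.2) a).symm
  smul_def' _ _ := rfl

theorem pPowers_algebraMap_injective :
    Function.Injective (algebraMap (pPowers R n p) (WeylAlgebra R n)) := Subtype.val_injective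

theorem natCast_pPowers_eq_zero : (p : pPowers R n p) = 0 := by
  have := congrArg (algebraMap R (pPowers R n p)) (CharP.cast_eq_zero R p)
  rwa [map_natCast, map_zero] at this

/-- The monomials in `x` and `d` of degree `< p` in each variable form a basis of the Weyl algebra
over the subalgebra generated by the `p`-th powers. -/
theorem exists_basis (hp : p.Prime) :
    ∃ b : Module.Basis (Fin n ⊕ Fin n → Fin p) (pPowers R n p) (WeylAlgebra R n),
      ∀ m, b m = isWeylPair.restrictedMonomial (pPowers R n p) p m := by
  have : NeZero p := ⟨hp.ne_zero⟩
  have hli := (isWeylPair (R := R) (n := n)).linearIndependent_restrictedMonomial (p := p)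
    (isUnit_natCast_of_lt_prime hp natCast_pPowers_eq_zero) pPowers_algebraMap_injective
  have hsp := (isWeylPair (R := R) (n := n)).span_restrictedMonomial (k := pPowers R n p) (p := p)
    (fun i => ⟨⟨_, Algebra.subset_adjoin (Or.inl ⟨i, rfl⟩)⟩, rfl⟩)
    (fun i => ⟨⟨_, Algebra.subset_adjoin (Or.inr ⟨i, rfl⟩)⟩, rfl⟩) (by
      rw [eq_top_iff]
      intro a _
      have ha : a ∈ Algebra.adjoin R (Set.range (x R n) ∪ Set.range (d R n)) :=
        adjoin_generators R n ▸ Algebra.mem_top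
      induction ha using Algebra.adjoin_induction with
      | mem y hy => exact Algebra.subset_adjoin hy
      | algebraMap r =>
        exact Subalgebra.algebraMap_mem _ (algebraMap R (pPowers R n p) r)
      | add y z _ _ hy hz => exact Subalgebra.add_mem _ (hy trivial) (hz trivial)
      | mul y z _ _ hy hz => exact Subalgebra.mul_mem _ (hy trivial) (hz trivial))
  exact ⟨Module.Basis.mk hli hsp.ge, fun m => Module.Basis.mk_apply hli hsp.ge m⟩

/-- Any Weyl pair in the Weyl algebra gives a basis over the subalgebra of `p`-th powers. -/
theorem exists_basis_of_isWeylPair (hp : p.Prime) {f g : Fin n → WeylAlgebra R n}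
    (h : IsWeylPair f g) :
    ∃ b : Module.Basis (Fin n ⊕ Fin n → Fin p) (pPowers R n p) (WeylAlgebra R n),
      ∀ m, b m = h.restrictedMonomial (pPowers R n p) p m := by
  have : NeZero p := ⟨hp.ne_zero⟩
  obtain ⟨b, hb⟩ := exists_basis (R := R) (n := n) hp
  exact h.exists_basis_of_basis (isUnit_natCast_of_lt_prime hp natCast_pPowers_eq_zero) b
    (by rw [hb, IsWeylPair.restrictedMonomial_zero])

theorem mem_pPowers_of_commute (hp : p.Prime) {f g : Fin n → WeylAlgebra R n}
    (h : IsWeylPair f g) {z : WeylAlgebra R n} (hf : ∀ i, Commute (f i) z)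
    (hg : ∀ i, Commute (g i) z) : z ∈ pPowers R n p := by
  have : NeZero p := ⟨hp.ne_zero⟩
  obtain ⟨b, hb⟩ := exists_basis_of_isWeylPair (p := p) hp h
  obtain ⟨c, rfl⟩ := h.mem_range_algebraMap_of_commute (k := pPowers R n p) (p := p)
    (isUnit_natCast_of_lt_prime hp natCast_pPowers_eq_zero) pPowers_algebraMap_injective (z := z)
    (by rw [← funext hb, b.span_eq]; trivial) hf hg
  exact c.2

theorem commute_of_mem_pPowers {c : WeylAlgebra R n} (hc : c ∈ pPowers R n p)
    (a : WeylAlgebra R n) : Commute a c :=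
  Subalgebra.mem_center_iff.1 (pPowers_le_center R n p hc) a

/-- As `c` is central, `φ c` commutes with the Weyl pair formed by the images of the generators. -/
theorem map_mem_pPowers (hp : p.Prime) (φ : WeylAlgebra R n →ₐ[R] WeylAlgebra R n) :
    ∀ c ∈ pPowers R n p, φ c ∈ pPowers R n p := fun _ hc =>
  mem_pPowers_of_commute hp (isWeylPair.map φ.toRingHom)
    (fun i => (commute_of_mem_pPowers hc (x R n i)).map φ)
    (fun i => (commute_of_mem_pPowers hc (d R n i)).map φ)

/-- An endomorphism of the Weyl algebra maps a suitable basis over the `p`-th powers to a basis. -/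
theorem exists_bases (hp : p.Prime) (φ : WeylAlgebra R n →ₐ[R] WeylAlgebra R n) :
    ∃ (ι : Type) (_ : Fintype ι) (i₀ : ι)
      (b b' : Module.Basis ι (pPowers R n p) (WeylAlgebra R n)),
      b i₀ = 1 ∧ ∀ i, φ (b i) = b' i := by
  have : NeZero p := ⟨hp.ne_zero⟩
  obtain ⟨b, hb⟩ := exists_basis (R := R) (n := n) hp
  obtain ⟨b', hb'⟩ := exists_basis_of_isWeylPair (R := R) (n := n) hp (isWeylPair.map φ.toRingHom)
  refine ⟨_, inferInstance, 0, b, b', by rw [hb, IsWeylPair.restrictedMonomial_zero], fun m => ?_⟩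
  rw [hb, hb']
  exact IsWeylPair.map_restrictedMonomial (pPowers R n p) (pPowers R n p) isWeylPair φ.toRingHom p m

/-! ### Bijectivity, invariants and finite generation. -/

theorem bijective_iff_bijective_restrict (hp : p.Prime)
    {φ : WeylAlgebra R n →ₐ[R] WeylAlgebra R n}
    (h : ∀ c ∈ pPowers R n p, φ c ∈ pPowers R n p) :
    Function.Bijective φ ↔ Function.Bijective (restrict φ h) := by
  obtain ⟨ι, _, i₀, b, b', h0, hb⟩ := exists_bases (p := p) hp φ
  have h0' : b' i₀ = 1 := by rw [← hb, h0, map_one]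
  constructor
  · rintro ⟨hi, hs⟩
    refine ⟨fun c c' e => Subtype.ext (hi (congrArg Subtype.val e)), fun c => ?_⟩
    obtain ⟨a, ha⟩ := hs c
    exact ⟨b.repr a i₀, by rw [← repr_map h hb, ha, repr_coe h0']⟩
  · rintro ⟨hi, hs⟩
    refine ⟨fun a a' e => b.ext_elem fun i => hi ?_, fun y => ?_⟩
    · rw [← repr_map h hb, ← repr_map h hb, e]
    · choose c hc using fun i => hs (b'.repr y i)
      refine ⟨∑ i, c i • b i, b'.ext_elem fun i => ?_⟩
      rw [repr_map h hb, b.repr_sum_self, hc]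

theorem isLinearOver_biTwist (hp : p.Prime) (φ : WeylAlgebra R n →ₐ[R] WeylAlgebra R n) :
    Bimodule.IsLinearOver (pPowers R n p) (BiTwist φ.toRingHom) := by
  intro c hc (m : WeylAlgebra R n)
  exact (commute_of_mem_pPowers (map_mem_pPowers hp φ c hc) m).symm

theorem mem_invariants_biTwist_iff (hp : p.Prime) (φ : WeylAlgebra R n →ₐ[R] WeylAlgebra R n)
    (m : WeylAlgebra R n) :
    BiTwist.of φ.toRingHom m ∈ Bimodule.invariants (pPowers R n p) (BiTwist φ.toRingHom)
      (pPowers_le_center R n p) ↔ m ∈ pPowers R n p :=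
  ⟨fun hm => mem_pPowers_of_commute hp (isWeylPair.map φ.toRingHom) (fun _ => hm _) fun _ => hm _,
    fun hm s => commute_of_mem_pPowers hm (φ s)⟩

/-- The invariants of `_φA_φ` are the `p`-th powers, as a module twisted by the restriction. -/
noncomputable def invariantsEquiv (hp : p.Prime) (φ : WeylAlgebra R n →ₐ[R] WeylAlgebra R n)
    (h : ∀ c ∈ pPowers R n p, φ c ∈ pPowers R n p) :
    LeftTwist (restrict φ h).toRingHom ≃ₗ[pPowers R n p]
      Bimodule.invariants (pPowers R n p) (BiTwist φ.toRingHom) (pPowers_le_center R n p) where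
  toFun c := ⟨BiTwist.of φ.toRingHom ((LeftTwist.of _).symm c : pPowers R n p),
    (mem_invariants_biTwist_iff hp φ _).2 ((LeftTwist.of _).symm c : pPowers R n p).2⟩
  invFun m := LeftTwist.of _ ⟨(BiTwist.of φ.toRingHom).symm m,
    (mem_invariants_biTwist_iff hp φ _).1 m.2⟩
  map_add' _ _ := rfl
  map_smul' _ _ := rfl
  left_inv _ := rfl
  right_inv _ := rfl

theorem finite_iff_finite_leftTwist {S : Type*} [CommRing S] (ψ : S →+* S) :
    ψ.Finite ↔ Module.Finite S (LeftTwist ψ) := Iff.rfl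

theorem fg_biTwist_iff_finite_restrict (hp : p.Prime)
    (φ : WeylAlgebra R n →ₐ[R] WeylAlgebra R n)
    (h : ∀ c ∈ pPowers R n p, φ c ∈ pPowers R n p) :
    Bimodule.FG (WeylAlgebra R n) (BiTwist φ.toRingHom) ↔ (restrict φ h).toRingHom.Finite := by
  classical
  obtain ⟨ι, _, i₀, b, b', h0, hb⟩ := exists_bases (p := p) hp φ
  have h0' : b' i₀ = 1 := by rw [← hb, h0, map_one]
  rw [finite_iff_finite_leftTwist]
  set ψ := (restrict φ h).toRingHom
  constructor
  · rintro ⟨G, hG⟩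
    let S : Finset (LeftTwist ψ) := (G ×ˢ Finset.univ).image fun q =>
      LeftTwist.of ψ (b'.repr ((BiTwist.of φ.toRingHom).symm q.1) q.2)
    let D : Submodule (pPowers R n p) (LeftTwist ψ) := Submodule.span _ (S : Set (LeftTwist ψ))
    have hD : ∀ (c : pPowers R n p) (s : pPowers R n p), LeftTwist.of ψ s ∈ D →
        LeftTwist.of ψ (restrict φ h c * s) ∈ D := fun c s hs => D.smul_mem c hs
    -- The elements whose coordinates all lie in the span `D` of the coordinates of the generators;
    -- the point is that `N` is a sub-bimodule.
    let N : AddSubgroup (BiTwist φ.toRingHom) :=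
      { carrier := {s | ∀ i, LeftTwist.of ψ (b'.repr ((BiTwist.of φ.toRingHom).symm s) i) ∈ D}
        zero_mem' := fun i => by
          rw [map_zero, map_zero, Finsupp.zero_apply, map_zero]; exact D.zero_mem
        add_mem' := fun hs ht i => by
          rw [map_add, map_add, Finsupp.add_apply, map_add]; exact D.add_mem (hs i) (ht i)
        neg_mem' := fun hs i => by
          rw [map_neg, map_neg, Finsupp.neg_apply, map_neg]; exact D.neg_mem (hs i) }
    -- Elements `φ (a j)` have coordinates in φ(C), and multiplication by φ(C) preserves `D`.
    have hsum : ∀ (u : ι → pPowers R n p) (a : ι → WeylAlgebra R n) (i : ι),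
        (∀ j, LeftTwist.of ψ (u j) ∈ D) →
        LeftTwist.of ψ (b'.repr (∑ j, u j • φ (a j)) i) ∈ D := by
      intro u a i hu
      rw [map_sum, Finsupp.finsetSum_apply, map_sum]
      refine D.sum_mem fun j _ => ?_
      rw [map_smul, Finsupp.smul_apply, repr_map h hb, smul_eq_mul, mul_comm]
      exact hD _ _ (hu j)
    have hN := hG N (fun g hg i => Submodule.subset_span
        (Finset.mem_coe.2 (Finset.mem_image.2 ⟨(g, i), Finset.mk_mem_product hg (Finset.mem_univ i), rfl⟩)))
      (fun a s hs i => by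
        -- The vectors of `b'` are themselves images, so `φ a * b' j = φ (a * b j)`.
        have e : (BiTwist.of φ.toRingHom).symm (a • s) =
            ∑ j, b'.repr ((BiTwist.of φ.toRingHom).symm s) j • φ (a * b j) := by
          change φ a * (BiTwist.of φ.toRingHom).symm s = _
          conv_lhs => rw [← b'.sum_repr ((BiTwist.of φ.toRingHom).symm s), Finset.mul_sum]
          exact Finset.sum_congr rfl fun j _ => by rw [mul_smul_comm, map_mul, hb]
        rw [e]
        exact hsum _ _ i hs)
      (fun a s hs i => by
        have e : (BiTwist.of φ.toRingHom).symm (op a • s) =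
            ∑ j, b'.repr ((BiTwist.of φ.toRingHom).symm s) j • φ (b j * a) := by
          change (BiTwist.of φ.toRingHom).symm s * φ a = _
          conv_lhs => rw [← b'.sum_repr ((BiTwist.of φ.toRingHom).symm s), Finset.sum_mul]
          exact Finset.sum_congr rfl fun j _ => by rw [smul_mul_assoc, map_mul, hb]
        rw [e]
        exact hsum _ _ i hs)
    refine ⟨⟨S, eq_top_iff.2 fun c _ => ?_⟩⟩
    have hc : BiTwist.of φ.toRingHom ((LeftTwist.of ψ).symm c : pPowers R n p) ∈ N :=
      hN ▸ AddSubgroup.mem_top _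
    have := hc i₀
    rwa [AddEquiv.symm_apply_apply, repr_coe h0', AddEquiv.apply_symm_apply] at this
  · rintro ⟨T, hT⟩
    refine ⟨T.image fun t => BiTwist.of φ.toRingHom ((LeftTwist.of ψ).symm t : pPowers R n p),
      fun N hTN hl hr => eq_top_iff.2 fun s _ => ?_⟩
    have hmem : ∀ c : LeftTwist ψ,
        BiTwist.of φ.toRingHom ((LeftTwist.of ψ).symm c : pPowers R n p) ∈ N := by
      intro c
      have hc : c ∈ Submodule.span (pPowers R n p) (T : Set (LeftTwist ψ)) :=
        hT ▸ Submodule.mem_top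
      induction hc using Submodule.span_induction with
      | mem t ht => exact hTN _ (Finset.mem_image_of_mem _ ht)
      | zero => exact N.zero_mem
      | add y z _ _ hy hz => exact N.add_mem hy hz
      | smul c y _ hy => exact hl c _ hy
    -- Generators of C over itself suffice: the right action of `b j` is multiplication by `b' j`.
    have e : s = ∑ j, op (b j) •
        BiTwist.of φ.toRingHom (b'.repr ((BiTwist.of φ.toRingHom).symm s) j : pPowers R n p) := by
      apply (BiTwist.of φ.toRingHom).symm.injective
      rw [map_sum]
      conv_lhs => rw [← b'.sum_repr ((BiTwist.of φ.toRingHom).symm s)]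
      refine Finset.sum_congr rfl fun j _ => ?_
      rw [BiTwist.op_smul_of, AddEquiv.symm_apply_apply, pPowers_smul_def, ← hb]
      rfl
    rw [e]
    exact N.sum_mem fun j _ => hr _ _ (hmem (LeftTwist.of ψ _))

end WeylAlgebra

theorem corollary2p5 {R : Type*} [CommRing R] (p : ℕ) (hp : p.Prime) [CharP R p] (n : ℕ)
    (φ : WeylAlgebra R n →ₐ[R] WeylAlgebra R n) :
    ∃ hφ : ∀ c ∈ WeylAlgebra.pPowers R n p, φ c ∈ WeylAlgebra.pPowers R n p,
      (Function.Bijective φ ↔ Function.Bijective (WeylAlgebra.restrict φ hφ)) ∧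
      Bimodule.IsLinearOver (WeylAlgebra.pPowers R n p) (BiTwist φ.toRingHom) ∧
      (∃ e : LeftTwist (WeylAlgebra.restrict φ hφ).toRingHom ≃ₗ[WeylAlgebra.pPowers R n p]
          Bimodule.invariants (WeylAlgebra.pPowers R n p) (BiTwist φ.toRingHom)
            (WeylAlgebra.pPowers_le_center R n p),
        ∀ c : WeylAlgebra.pPowers R n p,
          (e (LeftTwist.of _ c) : BiTwist φ.toRingHom)
            = BiTwist.of φ.toRingHom (c : WeylAlgebra R n)) ∧
      (Bimodule.FG (WeylAlgebra R n) (BiTwist φ.toRingHom) ↔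
        (WeylAlgebra.restrict φ hφ).toRingHom.Finite) :=
  ⟨WeylAlgebra.map_mem_pPowers hp φ, WeylAlgebra.bijective_iff_bijective_restrict hp _,
    WeylAlgebra.isLinearOver_biTwist hp φ,
    ⟨WeylAlgebra.invariantsEquiv hp φ _, fun _ => rfl⟩,
    WeylAlgebra.fg_biTwist_iff_finite_restrict hp φ _⟩
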